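/- Conventions. Rings are associative with unit and not necessarily commutative; modules are right modules; "Noetherian" means left and right Noetherian. A proper two-sided ideal $\mathfrak p$ of a ring $R$ is prime if for all two-sided ideals $I,J$ with $IJ\subseteq\mathfrak p$ one has $I\subseteq\mathfrak p$ or $J\subseteq\mathfrak p$; $R$ is a prime ring if $0$ is a prime ideal. A prime ideal $\mathfrak p$ is right localizable if the set $\mathcal C(\mathfrak p)$ of elements of $R$ that are regular modulo $\mathfrak p$ is a right denominator set (right Ore and right reversible). For an automorphism $\alpha$ of $R$, the skew-polynomial ring $R[z;\alpha]$ and the skew-Laurent ring $R[z^{\pm1};\alpha]$ are defined by the relation $zr=\alpha(r)z$ for $r\in R$. Theorem. Let $R$ be a prime Noetherian ring all of whose prime ideals are right localizable, and let $\alpha\colon R\to R$ be a ring automorphism. (1) Let $X$ be a finitely generated $R[z;\alpha]$-module. Suppose that there exist positive integers $r_j\to\infty$ and $R[z;\alpha]$-module automorphisms $w_j\colon X\to X$ such that $w_j^{r_j}$ is the multiplication by $z$ on the right, for every $j$. Then $X$ is finitely generated as an $R$-module. (2) Assume moreover that $R[z;\alpha]$ is also a prime Noetherian ring all of whose prime ideals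 are right localizable. Let $M$ be a finitely generated $R[z^{\pm1};\alpha]$-module. Suppose that there exist positive integers $r_j\to\infty$ and $R[z^{\pm1};\alpha]$-module automorphisms $w_j\colon M\to M$ such that $w_j^{r_j}$ is the multiplication by $z$ on the right, for every $j$. Then $M$ is finitely generated as an $R$-module. -/

import Mathlib

open Filter MulOpposite

universe u v

noncomputable section

namespace SkewFG

section Primes

variable {R : Type u} [Ring R]

/-- A prime ideal of a (not necessarily commutative) ring: a proper two-sided ideal `P` such that
`I J ⊆ P` implies `I ⊆ P` or `J ⊆ P` for all two-sided ideals `I`, `J`. -/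
structure IsPrimeIdeal (P : TwoSidedIdeal R) : Prop where
  ne_top : P ≠ ⊤
  le_or_le : ∀ I J : TwoSidedIdeal R, (∀ a ∈ I, ∀ b ∈ J, a * b ∈ P) → I ≤ P ∨ J ≤ P

/-- The multiplicative set `C(P)` of the elements of `R` that are regular modulo `P`. -/
def regularModulo (P : TwoSidedIdeal R) : Submonoid R where
  carrier := {c | (∀ x, c * x ∈ P → x ∈ P) ∧ ∀ x, x * c ∈ P → x ∈ P}
  one_mem' := by simp
  mul_mem' := by
    rintro c d ⟨hc, hc'⟩ ⟨hd, hd'⟩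
    refine ⟨fun x hx => hd x (hc _ ?_), fun x hx => hc' x (hd' _ ?_)⟩
    · rwa [← mul_assoc]
    · rwa [mul_assoc]

/-- `P` is right localizable: `C(P)` is a right denominator set of `R`, i.e. it is right Ore and
right reversible. As `OreLocalization.OreSet` is the left-handed notion, it is applied to the
opposite ring. -/
def IsRightLocalizable (P : TwoSidedIdeal R) : Prop :=
  Nonempty (OreLocalization.OreSet (regularModulo P).op)

end Primes

/-- `R` is a prime Noetherian (on both sides) ring all of whose prime ideals are right
localizable. -/
structure IsPrimeNoetherianLocalizable (R : Type u) [Ring R] : Prop where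
  isPrime : IsPrimeIdeal (⊥ : TwoSidedIdeal R)
  noetherian_left : IsNoetherianRing R
  noetherian_right : IsNoetherianRing Rᵐᵒᵖ
  localizable : ∀ P : TwoSidedIdeal R, IsPrimeIdeal P → IsRightLocalizable P

section SkewRings

variable {R : Type u} [Ring R] (α : R ≃+* R)

/-- The action of `ℕ` on `R` by the powers of `α`. -/
abbrev natAction : MulSemiringAction (Multiplicative ℕ) R :=
  MulSemiringAction.compHom R (powersHom (RingAut R) α)

/-- The action of `ℤ` on `R` by the powers of `α`. -/
abbrev intAction : MulSemiringAction (Multiplicative ℤ) R :=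
  MulSemiringAction.compHom R (zpowersHom (RingAut R) α)

/-- The skew-polynomial ring `R[z;α]`, with `z r = α(r) z`. -/
def SkewPoly (_α : R ≃+* R) : Type u := SkewPolynomial R

instance : Ring (SkewPoly α) :=
  letI := natAction α
  inferInstanceAs (Ring (SkewPolynomial R))

/-- The inclusion `R → R[z;α]`. -/
def SkewPoly.C : R →+* SkewPoly α :=
  letI := natAction α
  SkewPolynomial.CRingHom

/-- The variable `z` of `R[z;α]`. -/
def SkewPoly.z : SkewPoly α := SkewPolynomial.X (R := R)

/-- The skew-Laurent ring `R[z^{±1};α]`, with `z r = α(r) z`. -/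
def SkewLaurent (_α : R ≃+* R) : Type u := SkewMonoidAlgebra R (Multiplicative ℤ)

instance : Ring (SkewLaurent α) :=
  letI := intAction α
  inferInstanceAs (Ring (SkewMonoidAlgebra R (Multiplicative ℤ)))

/-- The inclusion `R → R[z^{±1};α]`. -/
def SkewLaurent.C : R →+* SkewLaurent α :=
  letI := intAction α
  SkewMonoidAlgebra.singleOneRingHom

/-- The variable `z` of `R[z^{±1};α]`. -/
def SkewLaurent.z : SkewLaurent α :=
  SkewMonoidAlgebra.single (k := R) (Multiplicative.ofAdd (1 : ℤ)) 1

end SkewRings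

section Modules

variable {A : Type u} [Ring A]

/-- The right `A`-module `X` admits `A`-module automorphisms `w_j` such that `w_j ^ r_j` is the
multiplication by `z` on the right, for some positive integers `r_j → ∞`. -/
def HasRootsOfMul (z : A) (X : Type v) [AddCommGroup X] [Module Aᵐᵒᵖ X] : Prop :=
  ∃ (r : ℕ → ℕ) (w : ℕ → (X ≃ₗ[Aᵐᵒᵖ] X)),
    (∀ j, 0 < r j) ∧ Tendsto r atTop atTop ∧ ∀ j x, (w j ^ r j) x = op z • x

/-- The right `A`-module `X` is finitely generated as a right `R`-module, where `R` acts through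
the ring homomorphism `f : R → A`. -/
def IsFGOver {R : Type u} [Ring R] (f : R →+* A) (X : Type v) [AddCommGroup X]
    [Module Aᵐᵒᵖ X] : Prop :=
  letI : Module Rᵐᵒᵖ X := Module.compHom X f.op
  Module.Finite Rᵐᵒᵖ X

end Modules

end SkewFG

end

/-! Right multiplication by `z` is an automorphism `ζ` of the `R`-module, being a power of one. Let
`V` be the `R`-span of finitely many generators and let the window `P n` be the sum of the `ζ ^ i V`
with `|i| ≤ n`. The windows are finitely generated over `R` and exhaust the module, so it suffices
that they stabilize.

Growth is measured by the ordinal length of Noetherian modules, which is superadditive for the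
ordinal sum and subadditive for the natural sum. Enlarging a window by one translate costs less and
less as the window widens, and ordinals are well-founded, so the lengths of the steps from `P n` to
`P (n + 1)` are eventually between some `o` and its natural double
(`exists_ordinalLength_window_bounds`).

If `o ≠ 0` has leading power `ω ^ d`, the growth over `n` steps lies between `ω ^ d * n` and `ω ^ d
* (2 * k * n + 1)` for a fixed `k`. A root `w` of order `r > 2 * k` has windows `W` with `P n ≤ W (r
* n) ≤ P (n + c)`, and their steps also have length at least `ω ^ d`. Then `r * n` such steps
outgrow the upper bound for large `n`, so `o = 0` (`window_stabilizes`). -/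

namespace SkewFG


/-! ### Natural sums of ordinals and powers of `ω`. -/

section NaturalSum

open Ordinal

/-- The natural (Hessenberg) sum of two ordinals: the least operation that is strictly monotone in
both arguments. -/
noncomputable def naturalSum (a b : Ordinal.{u}) : Ordinal.{u} :=
  max (⨆ x : Set.Iio a, Order.succ (naturalSum x.1 b))
    (⨆ x : Set.Iio b, Order.succ (naturalSum a x.1))
termination_by (a, b)
decreasing_by
  · exact Prod.Lex.left _ _ x.2
  · exact Prod.Lex.right _ x.2

theorem naturalSum_lt_left {x a : Ordinal.{u}} (h : x < a) (b : Ordinal.{u}) :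
    naturalSum x b < naturalSum a b := by
  rw [naturalSum.eq_1 a b]
  refine lt_max_of_lt_left (Order.lt_succ _ |>.trans_le ?_)
  exact Ordinal.le_iSup (fun x : Set.Iio a => Order.succ (naturalSum x.1 b)) ⟨x, h⟩

theorem naturalSum_lt_right {y b : Ordinal.{u}} (h : y < b) (a : Ordinal.{u}) :
    naturalSum a y < naturalSum a b := by
  rw [naturalSum.eq_1 a b]
  refine lt_max_of_lt_right (Order.lt_succ _ |>.trans_le ?_)
  exact Ordinal.le_iSup (fun x : Set.Iio b => Order.succ (naturalSum a x.1)) ⟨y, h⟩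

theorem naturalSum_le {a b o : Ordinal.{u}} (hl : ∀ x < a, naturalSum x b < o)
    (hr : ∀ y < b, naturalSum a y < o) : naturalSum a b ≤ o := by
  rw [naturalSum.eq_1 a b]
  exact max_le (Ordinal.iSup_le fun x => Order.succ_le_of_lt (hl x x.2))
    (Ordinal.iSup_le fun y => Order.succ_le_of_lt (hr y y.2))

theorem naturalSum_mono {a a' b b' : Ordinal.{u}} (ha : a ≤ a') (hb : b ≤ b') :
    naturalSum a b ≤ naturalSum a' b' := by
  have h1 : naturalSum a b ≤ naturalSum a' b := by
    rcases ha.eq_or_lt with rfl | h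
    · rfl
    · exact (naturalSum_lt_left h b).le
  have h2 : naturalSum a' b ≤ naturalSum a' b' := by
    rcases hb.eq_or_lt with rfl | h
    · rfl
    · exact (naturalSum_lt_right h a').le
  exact h1.trans h2

/-- Euclidean division by `ω ^ d` below a finite multiple of `ω ^ d`. -/
theorem exists_eq_opow_mul_add {d x : Ordinal.{u}} {i : ℕ} {y : Ordinal.{u}} (hy : y < ω ^ d)
    (hx : x < ω ^ d * i + y) :
    ∃ (k : ℕ) (x' : Ordinal.{u}), x = ω ^ d * k + x' ∧ x' < ω ^ d ∧ (k < i ∨ k = i ∧ x' < y) := by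
  have hpos : (ω : Ordinal.{u}) ^ d ≠ 0 := (Ordinal.opow_pos d omega0_pos).ne'
  have hdiv : x / ω ^ d < ((i + 1 : ℕ) : Ordinal.{u}) := by
    rw [← Ordinal.lt_mul_iff_div_lt hpos]
    refine hx.trans ?_
    rw [Nat.cast_add, Nat.cast_one, mul_add_one]
    gcongr
  obtain ⟨k, hk⟩ := Ordinal.lt_omega0.1 (hdiv.trans (natCast_lt_omega0 _))
  have hxk : x = ω ^ d * k + x % ω ^ d := by rw [← hk, Ordinal.div_add_mod]
  refine ⟨k, x % ω ^ d, hxk, Ordinal.mod_lt _ hpos, ?_⟩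
  rw [hk, Nat.cast_lt] at hdiv
  rcases Nat.lt_succ_iff_lt_or_eq.1 hdiv with h | rfl
  · exact Or.inl h
  · refine Or.inr ⟨rfl, ?_⟩
    rw [hxk] at hx
    simpa using hx

theorem opow_mul_add_lt {d x y : Ordinal.{u}} {i j : ℕ} (hij : i < j) (hx : x < ω ^ d) :
    ω ^ d * i + x < ω ^ d * j + y := by
  calc ω ^ d * (i : Ordinal.{u}) + x < ω ^ d * i + ω ^ d := by gcongr
    _ = ω ^ d * ((i + 1 : ℕ) : Ordinal.{u}) := by rw [Nat.cast_add, Nat.cast_one, mul_add_one]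
    _ ≤ ω ^ d * j := by gcongr; exact hij
    _ ≤ _ := le_self_add

/-- Lowering an argument either lowers its coefficient of `ω ^ d`, and then the closure of `ω ^ d`
absorbs the remainders, or keeps the coefficient and lowers the remainder. -/
theorem naturalSum_opow_mul_add_le {d : Ordinal.{u}}
    (hd : ∀ x < ω ^ d, ∀ y < ω ^ d, naturalSum x y < ω ^ d) (i j : ℕ) {x y : Ordinal.{u}}
    (hx : x < ω ^ d) (hy : y < ω ^ d) :
    naturalSum (ω ^ d * i + x) (ω ^ d * j + y) ≤ ω ^ d * (i + j : ℕ) + naturalSum x y := by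
  suffices H : ∀ p : Ordinal.{u} × Ordinal.{u}, ∀ (i j : ℕ) (x y : Ordinal.{u}), x < ω ^ d →
      y < ω ^ d → p = (ω ^ d * i + x, ω ^ d * j + y) →
      naturalSum (ω ^ d * i + x) (ω ^ d * j + y) ≤ ω ^ d * (i + j : ℕ) + naturalSum x y from
    H _ i j x y hx hy rfl
  intro p
  induction p using WellFoundedLT.induction with
  | ind p ih =>
  rintro i j x y hx hy rfl
  refine naturalSum_le (fun u hu => ?_) fun u hu => ?_
  · have hlt : (u, ω ^ d * (j : Ordinal.{u}) + y) < (ω ^ d * i + x, ω ^ d * j + y) :=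
      Prod.mk_lt_mk_of_lt_of_le hu le_rfl
    obtain ⟨k, u', rfl, hu', h⟩ := exists_eq_opow_mul_add hx hu
    refine (ih _ hlt k j u' y hu' hy rfl).trans_lt ?_
    rcases h with h | ⟨rfl, h⟩
    · exact opow_mul_add_lt (by lia) (hd _ hu' _ hy)
    · gcongr
      exact naturalSum_lt_left h y
  · have hlt : (ω ^ d * (i : Ordinal.{u}) + x, u) < (ω ^ d * i + x, ω ^ d * j + y) :=
      Prod.mk_lt_mk_of_le_of_lt le_rfl hu
    obtain ⟨k, u', rfl, hu', h⟩ := exists_eq_opow_mul_add hy hu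
    refine (ih _ hlt i k x u' hx hu' rfl).trans_lt ?_
    rcases h with h | ⟨rfl, h⟩
    · exact opow_mul_add_lt (by lia) (hd _ hx _ hu')
    · gcongr
      exact naturalSum_lt_right h x

theorem naturalSum_lt_opow_mul_of_closed {d : Ordinal.{u}}
    (hd : ∀ x < ω ^ d, ∀ y < ω ^ d, naturalSum x y < ω ^ d) {k l : ℕ} {x y : Ordinal.{u}}
    (hx : x < ω ^ d * k) (hy : y < ω ^ d * l) : naturalSum x y < ω ^ d * (k + l : ℕ) := by
  have hpos : 0 < (ω : Ordinal.{u}) ^ d := Ordinal.opow_pos d omega0_pos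
  rw [← add_zero (ω ^ d * _)] at hx hy
  obtain ⟨i, x', rfl, hx', h | h⟩ := exists_eq_opow_mul_add hpos hx
  swap
  · exact absurd h.2 not_lt_zero
  obtain ⟨j, y', rfl, hy', h' | h'⟩ := exists_eq_opow_mul_add hpos hy
  swap
  · exact absurd h'.2 not_lt_zero
  refine (naturalSum_opow_mul_add_le hd i j hx' hy').trans_lt ?_
  rw [← add_zero (ω ^ d * (k + l : ℕ))]
  exact opow_mul_add_lt (by lia) (hd _ hx' _ hy')

/-- Two ordinals below `ω ^ d`, `d ≠ 0`, lie below finite multiples of one smaller power of `ω`, to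
which the induction hypothesis applies. -/
theorem naturalSum_lt_opow (d : Ordinal.{u}) :
    ∀ x < ω ^ d, ∀ y < ω ^ d, naturalSum x y < ω ^ d := by
  induction d using WellFoundedLT.induction with
  | ind d ih =>
  intro x hx y hy
  rcases eq_or_ne d 0 with rfl | hd
  · rw [opow_zero, Order.lt_one_iff] at *
    subst hx hy
    exact le_antisymm (naturalSum_le (fun x hx => absurd hx not_lt_zero)
      (fun x hx => absurd hx not_lt_zero)) zero_le
  obtain ⟨e, he, m, hm⟩ := (lt_omega0_opow hd).1 hx
  obtain ⟨e', he', n, hn⟩ := (lt_omega0_opow hd).1 hy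
  have hE : max e e' < d := max_lt he he'
  refine (naturalSum_lt_opow_mul_of_closed (d := max e e') (ih _ hE) (k := m) (l := n) ?_ ?_).trans
    (opow_mul_lt_opow (natCast_lt_omega0 _) hE)
  · refine hm.trans_le ?_
    gcongr
    · exact omega0_pos
    · exact le_max_left _ _
  · refine hn.trans_le ?_
    gcongr
    · exact omega0_pos
    · exact le_max_right _ _

/-- The natural sum respects finite multiples of a power of `ω`. -/
theorem naturalSum_lt_opow_mul {d : Ordinal.{u}} {k l : ℕ} {x y : Ordinal.{u}}
    (hx : x < ω ^ d * k) (hy : y < ω ^ d * l) : naturalSum x y < ω ^ d * (k + l : ℕ) :=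
  naturalSum_lt_opow_mul_of_closed (naturalSum_lt_opow d) hx hy

end NaturalSum


/-! ### Ordinal length of intervals in a lattice. -/

section Length

variable {L : Type u}

/-- The relation whose descending chains are the ascending chains of `L` bounded by `b`. -/
def AscendsBelow [Preorder L] (b x y : L) : Prop := y < x ∧ x ≤ b

/-- The ascending chain condition below `b`. -/
def IsNoetherianBelow [Preorder L] (b : L) : Prop := WellFounded (AscendsBelow b)

theorem IsNoetherianBelow.mono [Preorder L] {b c : L} (hc : IsNoetherianBelow c) (h : b ≤ c) :
    IsNoetherianBelow b :=
  Subrelation.wf (fun ⟨h₁, h₂⟩ => ⟨h₁, h₂.trans h⟩) hc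

open Classical in
/-- The ordinal length of the interval `[a, b]` when the ascending chain condition holds
below `b`. -/
noncomputable def ordinalLength [Preorder L] (a b : L) : Ordinal.{u} :=
  if h : IsNoetherianBelow b then (h.apply a).rank else 0

section PartialOrder

variable [PartialOrder L] {a b c x : L}

theorem ordinalLength_lt (hb : IsNoetherianBelow b) (hax : a < x) (hxb : x ≤ b) :
    ordinalLength x b < ordinalLength a b := by
  rw [ordinalLength, ordinalLength, dif_pos hb, dif_pos hb]
  exact Acc.rank_lt_of_rel (hb.apply a) ⟨hax, hxb⟩

theorem ordinalLength_le {o : Ordinal.{u}} (hb : IsNoetherianBelow b)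
    (h : ∀ x, a < x → x ≤ b → ordinalLength x b < o) : ordinalLength a b ≤ o := by
  rw [ordinalLength, dif_pos hb, Acc.rank_eq]
  refine Ordinal.iSup_le fun x => Order.succ_le_of_lt ?_
  have := h x x.2.1 x.2.2
  rwa [ordinalLength, dif_pos hb] at this

theorem ordinalLength_anti_left (hb : IsNoetherianBelow b) (hax : a ≤ x) (hxb : x ≤ b) :
    ordinalLength x b ≤ ordinalLength a b := by
  rcases hax.eq_or_lt with rfl | h
  · rfl
  · exact (ordinalLength_lt hb h hxb).le

theorem ordinalLength_mono_right (hc : IsNoetherianBelow c) (hbc : b ≤ c) (a : L) :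
    ordinalLength a b ≤ ordinalLength a c := by
  have hb := hc.mono hbc
  induction a using hb.induction with
  | _ a ih =>
  refine ordinalLength_le hb fun x hax hxb => ?_
  exact (ih x ⟨hax, hxb⟩).trans_lt (ordinalLength_lt hc hax (hxb.trans hbc))

theorem ordinalLength_mono {a' b' : L} (hb : IsNoetherianBelow b) (ha : a ≤ a') (hab : a' ≤ b)
    (hbb : b' ≤ b) : ordinalLength a' b' ≤ ordinalLength a b :=
  (ordinalLength_mono_right hb hbb a').trans (ordinalLength_anti_left hb ha hab)

theorem ordinalLength_self (hb : IsNoetherianBelow b) : ordinalLength b b = 0 :=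
  le_antisymm (ordinalLength_le hb fun _ h h' => absurd h h'.not_gt) zero_le

theorem eq_of_ordinalLength_eq_zero (hb : IsNoetherianBelow b) (hab : a ≤ b)
    (h : ordinalLength a b = 0) : a = b := by
  by_contra hne
  have := ordinalLength_lt hb (lt_of_le_of_ne hab hne) le_rfl
  simp [h] at this

/-- Ascending chains in `[a, b]` continue into `[b, c]`. The rank counts what is still ahead, so the
upper interval is the left summand. -/
theorem ordinalLength_add_le (hc : IsNoetherianBelow c) (hab : a ≤ b) (hbc : b ≤ c) :
    ordinalLength b c + ordinalLength a b ≤ ordinalLength a c := by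
  have hb := hc.mono hbc
  induction a using hb.induction with
  | _ a ih =>
  by_contra! hlt
  have hlt' : ∃ o < ordinalLength a b, ordinalLength a c ≤ ordinalLength b c + o := by
    obtain ⟨o, ho⟩ := exists_add_of_le (ordinalLength_anti_left hc hab hbc)
    refine ⟨o, ?_, ho.le⟩
    rw [ho] at hlt
    simpa using hlt
  obtain ⟨o, ho, hle⟩ := hlt'
  have : ∃ x, a < x ∧ x ≤ b ∧ o ≤ ordinalLength x b := by
    by_contra! hx
    exact (ordinalLength_le hb hx).not_gt ho
  obtain ⟨x, hax, hxb, hox⟩ := this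
  have h1 := ih x ⟨hax, hxb⟩ hxb
  have h2 := ordinalLength_lt hc hax (hxb.trans hbc)
  have h3 : ordinalLength b c + o ≤ ordinalLength b c + ordinalLength x b := by gcongr
  exact ((hle.trans h3).trans h1).not_gt h2

theorem ordinalLength_map_le (φ : L ≃o L) (hφ : IsNoetherianBelow (φ b))
    (hb : IsNoetherianBelow b) (a : L) :
    ordinalLength a b ≤ ordinalLength (φ a) (φ b) := by
  induction a using hb.induction with
  | _ a ih =>
  refine ordinalLength_le hb fun x hax hxb => ?_
  exact (ih x ⟨hax, hxb⟩).trans_lt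
    (ordinalLength_lt hφ (φ.lt_iff_lt.2 hax) (φ.le_iff_le.2 hxb))

theorem ordinalLength_map (φ : L ≃o L) (hφ : IsNoetherianBelow (φ b))
    (hb : IsNoetherianBelow b) (a : L) :
    ordinalLength (φ a) (φ b) = ordinalLength a b := by
  refine le_antisymm ?_ (ordinalLength_map_le φ hφ hb a)
  have := ordinalLength_map_le (b := φ b) φ.symm (by simpa using hb) hφ (φ a)
  simpa using this

/-- Iterated superadditivity of the length. -/
theorem mul_le_ordinalLength_of_chain (s : ℕ → L) (hs : Monotone s)
    (hN : ∀ n, IsNoetherianBelow (s n)) {o : Ordinal.{u}}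
    (ho : ∀ n, o ≤ ordinalLength (s n) (s (n + 1))) (m n : ℕ) :
    o * n ≤ ordinalLength (s m) (s (m + n)) := by
  induction n generalizing m with
  | zero => simp
  | succ n ih =>
    rw [Nat.cast_add, Nat.cast_one, mul_add_one]
    have h := ih (m + 1)
    rw [show m + 1 + n = m + (n + 1) by lia] at h
    calc _ ≤ _ := add_le_add h (ho m)
      _ ≤ _ := ordinalLength_add_le (hN _) (hs (by lia)) (hs (by lia))

end PartialOrder

section Modular

variable [Lattice L] [IsModularLattice L] {a b c x : L}

/-- By modularity, when `x` strictly increases, `x ⊔ b` or `x ⊓ b` strictly increases, and the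
natural sum is strictly monotone in both arguments. -/
theorem ordinalLength_le_naturalSum_sup_inf (hc : IsNoetherianBelow c) (hbc : b ≤ c) (hx : x ≤ c) :
    ordinalLength x c ≤ naturalSum (ordinalLength (x ⊔ b) c) (ordinalLength (x ⊓ b) b) := by
  have hb := hc.mono hbc
  induction x using hc.induction with
  | _ x ih =>
  refine ordinalLength_le hc fun y hxy hyc => (ih y ⟨hxy, hyc⟩ hyc).trans_lt ?_
  by_cases h : y ⊓ b ≤ x ⊓ b
  · refine (naturalSum_lt_left (ordinalLength_lt hc (sup_lt_sup_of_lt_of_inf_le_inf hxy h)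
      (sup_le hyc hbc)) _).trans_le ?_
    refine naturalSum_mono le_rfl (ordinalLength_anti_left hb ?_ inf_le_right)
    gcongr
  · refine (naturalSum_lt_right (ordinalLength_lt hb (lt_of_le_not_ge ?_ h) inf_le_right)
      _).trans_le ?_
    · gcongr
    · refine naturalSum_mono (ordinalLength_anti_left hc ?_ (sup_le hyc hbc)) le_rfl
      gcongr

/-- Subadditivity of the length. -/
theorem ordinalLength_le_naturalSum (hc : IsNoetherianBelow c) (hab : a ≤ b) (hbc : b ≤ c) :
    ordinalLength a c ≤ naturalSum (ordinalLength b c) (ordinalLength a b) := by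
  have := ordinalLength_le_naturalSum_sup_inf hc hbc (hab.trans hbc)
  rwa [sup_eq_right.2 hab, inf_eq_left.2 hab] at this

/-- One half of the second isomorphism theorem: by modularity, `y ↦ y ⊓ a` is strictly increasing on
`[b, a ⊔ b]`. -/
theorem ordinalLength_sup_le (h : IsNoetherianBelow (a ⊔ b)) :
    ordinalLength b (a ⊔ b) ≤ ordinalLength (b ⊓ a) a := by
  have ha := h.mono le_sup_left
  suffices H : ∀ x, b ≤ x → ordinalLength x (a ⊔ b) ≤ ordinalLength (x ⊓ a) a from H b le_rfl
  intro x
  induction x using h.induction with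
  | _ x ih =>
  intro hbx
  refine ordinalLength_le h fun y hxy hy => (ih y ⟨hxy, hy⟩ (hbx.trans hxy.le)).trans_lt ?_
  refine ordinalLength_lt ha (lt_of_le_not_ge (by gcongr) fun hle => ?_) inf_le_right
  refine hxy.not_ge ?_
  calc y = (b ⊔ a) ⊓ y := by rw [sup_comm, inf_eq_right.2 hy]
    _ = b ⊔ a ⊓ y := sup_inf_assoc_of_le a (hbx.trans hxy.le)
    _ ≤ x := sup_le hbx ((inf_comm a y).le.trans (hle.trans inf_le_left))

open Ordinal in
theorem ordinalLength_lt_opow_of_chain (s : ℕ → L) (hs : Monotone s)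
    (hN : ∀ n, IsNoetherianBelow (s n)) {d : Ordinal.{u}} {m₀ : ℕ}
    (hd : ∀ n ≥ m₀, ordinalLength (s n) (s (n + 1)) < ω ^ d) (n : ℕ) :
    ordinalLength (s m₀) (s (m₀ + n)) < ω ^ d := by
  induction n with
  | zero => simpa [ordinalLength_self (hN m₀)] using Ordinal.opow_pos d omega0_pos
  | succ n ih =>
    exact (ordinalLength_le_naturalSum (hN (m₀ + (n + 1))) (hs (Nat.le_add_right m₀ n))
      (hs (by lia))).trans_lt (naturalSum_lt_opow d _ (hd (m₀ + n) (by lia)) _ ih)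

open Ordinal in
/-- Iterated subadditivity of the length, in terms of finite multiples of `ω ^ d`. -/
theorem ordinalLength_lt_of_chain (s : ℕ → L) (hs : Monotone s)
    (hN : ∀ n, IsNoetherianBelow (s n)) {d : Ordinal.{u}} {k m₀ : ℕ}
    (hk : ∀ n ≥ m₀, ordinalLength (s n) (s (n + 1)) < ω ^ d * k) (n : ℕ) :
    ordinalLength (s m₀) (s (m₀ + n)) < ω ^ d * (k * n + 1 : ℕ) := by
  induction n with
  | zero => simpa [ordinalLength_self (hN m₀)] using Ordinal.opow_pos d omega0_pos
  | succ n ih =>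
    refine (ordinalLength_le_naturalSum (hN (m₀ + (n + 1))) (hs (Nat.le_add_right m₀ n))
      (hs (by lia))).trans_lt ?_
    have := naturalSum_lt_opow_mul (hk (m₀ + n) (by lia)) ih
    rwa [show k + (k * n + 1) = k * (n + 1) + 1 by ring] at this

end Modular

end Length


/-! ### Windows of translates and their growth. -/

section Windows

variable {L : Type u} [Lattice L] [OrderBot L]

/-- The join of the translates `φ ^ i V` with `a ≤ i ≤ b`. -/
noncomputable def window (φ : L ≃o L) (V : L) (a b : ℤ) : L := (Finset.Icc a b).sup fun i => (φ ^ i) V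

variable {φ : L ≃o L} {V : L}

theorem le_window {a b i : ℤ} (ha : a ≤ i) (hb : i ≤ b) : (φ ^ i) V ≤ window φ V a b :=
  Finset.le_sup (f := fun i => (φ ^ i) V) (Finset.mem_Icc.2 ⟨ha, hb⟩)

theorem window_le {a b : ℤ} {x : L} (h : ∀ i, a ≤ i → i ≤ b → (φ ^ i) V ≤ x) :
    window φ V a b ≤ x :=
  Finset.sup_le fun i hi => h i (Finset.mem_Icc.1 hi).1 (Finset.mem_Icc.1 hi).2

theorem window_mono {a a' b b' : ℤ} (ha : a' ≤ a) (hb : b ≤ b') :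
    window φ V a b ≤ window φ V a' b' :=
  window_le fun _ h h' => le_window (ha.trans h) (h'.trans hb)

theorem map_window_le (k a b : ℤ) :
    (φ ^ k) (window φ V a b) ≤ window φ V (a + k) (b + k) := by
  rw [window, map_finset_sup]
  refine Finset.sup_le fun i hi => ?_
  rw [Finset.mem_Icc] at hi
  have := le_window (φ := φ) (V := V) (a := a + k) (b := b + k) (i := k + i) (by lia) (by lia)
  rwa [zpow_add] at this

theorem map_window (k a b : ℤ) :
    (φ ^ k) (window φ V a b) = window φ V (a + k) (b + k) := by
  refine le_antisymm (map_window_le k a b) ?_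
  have h := (φ ^ k).monotone (map_window_le (φ := φ) (V := V) (-k) (a + k) (b + k))
  rw [add_neg_cancel_right, add_neg_cancel_right] at h
  refine le_trans (le_of_eq ?_) h
  rw [← RelIso.mul_apply, ← zpow_add, add_neg_cancel, zpow_zero, RelIso.one_apply]

theorem window_eq_sup {a b : ℤ} (h : a ≤ b) :
    window φ V a (b + 1) = window φ V (a + 1) (b + 1) ⊔ window φ V a b := by
  refine le_antisymm (window_le fun i hi hi' => ?_)
    (sup_le (window_mono (by lia) le_rfl) (window_mono le_rfl (by lia)))
  by_cases hib : i ≤ b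
  · exact le_sup_of_le_right (le_window hi hib)
  · exact le_sup_of_le_left (le_window (by lia) hi')

theorem monotone_window : Monotone fun n : ℕ => window φ V (-n) n :=
  fun _ _ h => window_mono (by lia) (by lia)

theorem window_le_window_of_pow_eq {w : L ≃o L} {r : ℕ} (hw : w ^ r = φ) (n : ℕ) :
    window φ V (-n) n ≤ window w V (-(r * n : ℕ)) (r * n : ℕ) := by
  refine window_le fun i hi hi' => ?_
  rw [← hw, ← zpow_natCast, ← zpow_mul]
  refine le_window ?_ ?_ <;> push_cast <;> nlinarith

/-- Writing `i = r * q + s` with `0 ≤ s < r` gives `w ^ i = φ ^ q * w ^ s`, so only the finitely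
many `w ^ s V` matter, and `c` does not depend on `n`. -/
theorem exists_window_le_window_of_pow_eq {w : L ≃o L} {r : ℕ} (hr : 0 < r) (hw : w ^ r = φ)
    (hV : ∀ i : ℕ, ∃ c : ℕ, (w ^ i) V ≤ window φ V (-c) c) :
    ∃ c : ℕ, ∀ n : ℕ, window w V (-(r * n : ℕ)) (r * n : ℕ) ≤
      window φ V (-(n + c : ℕ)) (n + c : ℕ) := by
  choose c hc using hV
  refine ⟨(Finset.range r).sup c, fun n => window_le fun i hi hi' => ?_⟩
  have hr' : (0 : ℤ) < r := by exact_mod_cast hr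
  obtain ⟨s, hs⟩ := Int.eq_ofNat_of_zero_le (Int.emod_nonneg i hr'.ne')
  have hsr : s < r := by have := Int.emod_lt_of_pos i hr'; lia
  have hcs : c s ≤ (Finset.range r).sup c := Finset.le_sup (Finset.mem_range.2 hsr)
  have hi_eq : i = r * (i / r) + s := by rw [← hs, Int.mul_ediv_add_emod]
  have hq : -(n : ℤ) ≤ i / r := by
    rw [Int.le_ediv_iff_mul_le hr']; push_cast at hi; linarith
  have hq' : i / r ≤ n := by
    push_cast at hi'
    exact Int.ediv_le_of_le_mul hr' (by linarith)
  have hz : w ^ i = φ ^ (i / r) * w ^ s := by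
    rw [← hw, ← zpow_natCast w r, ← zpow_mul, ← zpow_natCast w s, ← zpow_add, ← hi_eq]
  rw [hz, RelIso.mul_apply]
  refine ((φ ^ (i / (r : ℤ))).monotone (hc s)).trans ?_
  rw [map_window]
  refine window_mono ?_ ?_ <;> push_cast <;> lia

/-- The lengths of the steps `[W, W']` of the windows `W ⊆ W'` of widths `n` and `n + 1`, the larger
of the two ways to enlarge `W`. -/
noncomputable def windowStep (φ : L ≃o L) (V : L) (n : ℕ) : Ordinal.{u} :=
  max (ordinalLength (window φ V 0 n) (window φ V 0 (n + 1)))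
    (ordinalLength (window φ V 1 (n + 1)) (window φ V 0 (n + 1)))

theorem ordinalLength_window_shift (hN : ∀ a b, IsNoetherianBelow (window φ V a b))
    (k a b a' b' : ℤ) :
    ordinalLength (window φ V (a + k) (b + k)) (window φ V (a' + k) (b' + k)) =
      ordinalLength (window φ V a b) (window φ V a' b') := by
  rw [← map_window, ← map_window, ordinalLength_map _ _ (hN _ _)]
  rw [map_window]
  exact hN _ _

theorem windowStep_le_ordinalLength (hN : ∀ a b, IsNoetherianBelow (window φ V a b)) (n : ℕ) :
    windowStep φ V (2 * n + 1) ≤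
      ordinalLength (window φ V (-n) n) (window φ V (-(n + 1 : ℕ)) (n + 1 : ℕ)) := by
  push_cast
  refine max_le ?_ ?_ <;> push_cast
  · rw [← ordinalLength_window_shift hN (-(n + 1)) 0, zero_add,
      show (2 * n + 1 + -(n + 1) : ℤ) = n by ring, show (2 * n + 1 + 1 + -(n + 1) : ℤ) = n + 1 by ring]
    exact ordinalLength_anti_left (hN _ _) (window_mono (by lia) le_rfl) (window_mono le_rfl (by lia))
  · rw [← ordinalLength_window_shift hN (-(n + 1)) 1, zero_add,
      show (1 + -(n + 1) : ℤ) = -n by ring, show (2 * n + 1 + 1 + -(n + 1) : ℤ) = n + 1 by ring]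
    exact ordinalLength_anti_left (hN _ _) (window_mono le_rfl (by lia)) (window_mono (by lia) le_rfl)

variable [IsModularLattice L]

/-- A wider window is the join of two overlapping narrower ones. The second isomorphism theorem
bounds its step by a step of the narrower window, up to translation, which preserves length. -/
theorem antitone_windowStep (hN : ∀ a b, IsNoetherianBelow (window φ V a b)) :
    Antitone (windowStep φ V) := by
  refine antitone_nat_of_succ_le fun n => ?_
  have hsup := window_eq_sup (φ := φ) (V := V) (a := 0) (b := n + 1) (by lia)
  have hle : window φ V 1 (n + 1) ≤ window φ V (0 + 1) (n + 1 + 1) ⊓ window φ V 0 (n + 1) :=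
    le_inf (window_mono (by lia) (by lia)) (window_mono (by lia) le_rfl)
  have hnoeth := hN 0 (n + 1 + 1)
  unfold windowStep
  push_cast
  refine max_le_max ?_ ?_
  · rw [hsup] at hnoeth ⊢
    refine (ordinalLength_sup_le hnoeth).trans ?_
    refine (ordinalLength_anti_left (hN _ _) (hle.trans (inf_comm _ _).le) inf_le_right).trans ?_
    have := ordinalLength_window_shift hN 1 0 n 0 (n + 1)
    exact this.le
  · rw [hsup, sup_comm] at hnoeth ⊢
    refine (ordinalLength_sup_le hnoeth).trans ?_
    exact ordinalLength_anti_left (hN _ _) hle inf_le_right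

theorem ordinalLength_le_windowStep (hN : ∀ a b, IsNoetherianBelow (window φ V a b)) (n : ℕ) :
    ordinalLength (window φ V (-n) n) (window φ V (-(n + 1 : ℕ)) (n + 1 : ℕ)) ≤
      naturalSum (windowStep φ V (2 * n)) (windowStep φ V (2 * n)) := by
  push_cast
  refine (ordinalLength_le_naturalSum (b := window φ V (-n) (n + 1)) (hN _ _)
    (window_mono le_rfl (by lia)) (window_mono (by lia) le_rfl)).trans (naturalSum_mono ?_ ?_)
  · refine le_trans ?_ (antitone_windowStep hN (Nat.le_succ (2 * n)))
    refine le_max_of_le_right (le_of_eq ?_)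
    push_cast
    rw [← ordinalLength_window_shift hN (-(n + 1)) 1, zero_add,
      show (1 + -(n + 1) : ℤ) = -n by ring, show (2 * n + 1 + 1 + -(n + 1) : ℤ) = n + 1 by ring]
  · refine le_max_of_le_left (le_of_eq ?_)
    push_cast
    rw [← ordinalLength_window_shift hN (-n) 0, zero_add,
      show (2 * n + -n : ℤ) = n by ring, show (2 * n + 1 + -n : ℤ) = n + 1 by ring]

/-- The lengths of the steps between the symmetric windows are eventually pinned between an
ordinal and twice that ordinal. -/
theorem exists_ordinalLength_window_bounds (hN : ∀ a b, IsNoetherianBelow (window φ V a b)) :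
    ∃ (o : Ordinal.{u}) (n₀ : ℕ),
      (∀ n : ℕ, o ≤ ordinalLength (window φ V (-n) n) (window φ V (-(n + 1 : ℕ)) (n + 1 : ℕ))) ∧
      ∀ n : ℕ, n₀ ≤ n →
        ordinalLength (window φ V (-n) n) (window φ V (-(n + 1 : ℕ)) (n + 1 : ℕ)) ≤
          naturalSum o o := by
  -- The least step length serves as `o`: antitonicity makes the steps equal to it from index `m`
  -- on.
  obtain ⟨_, ⟨m, rfl⟩, hm⟩ := WellFounded.has_min (wellFounded_lt (α := Ordinal.{u}))
    (Set.range (windowStep φ V)) (Set.range_nonempty _)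
  refine ⟨windowStep φ V m, m, fun n => ?_, fun n hn => ?_⟩
  · exact (not_lt.1 (hm _ ⟨_, rfl⟩)).trans (windowStep_le_ordinalLength hN n)
  · have := antitone_windowStep hN (show m ≤ 2 * n by lia)
    exact (ordinalLength_le_windowStep hN n).trans (naturalSum_mono this this)

open Ordinal in
/-- If an automorphism `φ` of a modular lattice has roots of unbounded order that are compatible
with the windows of `V`, then these windows stabilize. -/
theorem window_stabilizes (hN : ∀ a b, IsNoetherianBelow (window φ V a b))
    (hroots : ∀ K : ℕ, ∃ r > K, ∃ w : L ≃o L, w ^ r = φ ∧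
      ∀ i : ℕ, ∃ c : ℕ, (w ^ i) V ≤ window φ V (-c) c) :
    ∃ n₀ : ℕ, ∀ n : ℕ, n₀ ≤ n → window φ V (-n) n = window φ V (-n₀) n₀ := by
  obtain ⟨o, n₀, hlow, hup⟩ := exists_ordinalLength_window_bounds hN
  set P : ℕ → L := fun n => window φ V (-n) n with hP
  have hPmono : Monotone P := monotone_window
  have hPN : ∀ n, IsNoetherianBelow (P n) := fun n => hN _ _
  refine ⟨n₀, ?_⟩
  rcases eq_or_ne o 0 with rfl | ho
  · intro n hn
    induction n, hn using Nat.le_induction with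
    | base => rfl
    | succ n hn ih =>
      rw [← ih]
      refine (eq_of_ordinalLength_eq_zero (hPN (n + 1)) (hPmono n.le_succ) ?_).symm
      refine le_antisymm ((hup n hn).trans ?_) zero_le
      exact naturalSum_le (fun x hx => absurd hx not_lt_zero) fun x hx => absurd hx not_lt_zero
  exfalso
  -- `ω ^ d` is the leading power in the Cantor normal form of `o`, and `k` exceeds its coefficient.
  obtain ⟨d, k, hd, hk⟩ : ∃ (d : Ordinal.{u}) (k : ℕ), ω ^ d ≤ o ∧ o < ω ^ d * k :=
    ⟨log ω o, _, opow_log_le_self ω ho,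
      (lt_omega0_opow_succ.1 (lt_opow_succ_log_self one_lt_omega0 o)).choose_spec⟩
  have hpos : 0 < (ω : Ordinal.{u}) ^ d := Ordinal.opow_pos d omega0_pos
  have hPup : ∀ n, ordinalLength (P n₀) (P (n₀ + n)) < ω ^ d * ((k + k) * n + 1 : ℕ) :=
    ordinalLength_lt_of_chain P hPmono hPN fun n hn =>
      (hup n hn).trans_lt (naturalSum_lt_opow_mul hk hk)
  have hPlow : ∀ n, ω ^ d * n ≤ ordinalLength (P n₀) (P (n₀ + n)) :=
    mul_le_ordinalLength_of_chain P hPmono hPN (fun n => hd.trans (hlow n)) n₀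
  obtain ⟨r, hr, w, hw, hV⟩ := hroots (k + k)
  have hr0 : 0 < r := by lia
  obtain ⟨c, hc⟩ := exists_window_le_window_of_pow_eq hr0 hw hV
  set W : ℕ → L := fun n => window w V (-n) n with hW
  have hPW : ∀ n, P n ≤ W (r * n) := window_le_window_of_pow_eq hw
  have hWP : ∀ n, W (r * n) ≤ P (n + c) := hc
  have hWmono : Monotone W := monotone_window
  have hwN : ∀ a b, IsNoetherianBelow (window w V a b) := fun a b => by
    refine (hPN (max a.natAbs b.natAbs + c)).mono (le_trans ?_ (hWP _))
    have : ((max a.natAbs b.natAbs : ℕ) : ℤ) ≤ (r * max a.natAbs b.natAbs : ℕ) := by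
      exact_mod_cast Nat.le_mul_of_pos_left _ hr0
    exact window_mono (by lia) (by lia)
  have hWN : ∀ n, IsNoetherianBelow (W n) := fun n => hwN _ _
  obtain ⟨o', m₀, hlow', hup'⟩ := exists_ordinalLength_window_bounds hwN
  -- Otherwise the late steps of `W` stay below `ω ^ d`, and so does any finite number of them
  -- together. Then from `P n₀` the growth never reaches `ω ^ d * (B + 1)`, whereas `m₀ + B + 1`
  -- steps of `P` do reach it.
  have hdo' : ω ^ d ≤ o' := by
    by_contra! hlt
    have hm₀ : m₀ ≤ r * (n₀ + m₀) := by nlinarith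
    have hWsmall : ∀ n, ordinalLength (W (r * (n₀ + m₀))) (W (r * (n₀ + m₀) + n)) < ω ^ d :=
      ordinalLength_lt_opow_of_chain W hWmono hWN fun n hn =>
        (hup' n (hm₀.trans hn)).trans_lt (naturalSum_lt_opow d _ hlt _ hlt)
    have h1 : P n₀ ≤ W (r * (n₀ + m₀)) := (hPmono (Nat.le_add_right _ _)).trans (hPW _)
    have h2 : ordinalLength (P n₀) (W (r * (n₀ + m₀))) < ω ^ d * ((k + k) * (m₀ + c) + 1 : ℕ) := by
      refine (ordinalLength_mono_right (hPN _) (hWP _) _).trans_lt ?_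
      rw [add_assoc]
      exact hPup _
    set B := (k + k) * (m₀ + c) + 1
    have h3 : ordinalLength (P n₀) (W (r * (n₀ + m₀) + r * (B + 1))) < ω ^ d * (1 + B : ℕ) := by
      refine (ordinalLength_le_naturalSum (hWN _) h1 (hWmono (Nat.le_add_right _ _))).trans_lt ?_
      refine naturalSum_lt_opow_mul ?_ h2
      simpa using hWsmall (r * (B + 1))
    have h4 : P (n₀ + (m₀ + (B + 1))) ≤ W (r * (n₀ + m₀) + r * (B + 1)) := by
      rw [← mul_add, ← add_assoc n₀ m₀]
      exact hPW _
    have h5 := ((hPlow _).trans (ordinalLength_mono_right (hWN _) h4 _)).trans_lt h3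
    rw [mul_lt_mul_iff_right₀ hpos, Nat.cast_lt] at h5
    lia
  -- Comparing coefficients of `ω ^ d` gives `r * t < 2 * k * (t + c) + 1`; as `r ≥ 2 * k + 1`, this
  -- forces `t < 2 * k * c + 1`, which this `t` violates.
  set t := (k + k) * c + 1 with ht
  have h1 := mul_le_ordinalLength_of_chain W hWmono hWN (fun n => hdo'.trans (hlow' n))
    (r * n₀) (r * t)
  rw [← mul_add] at h1
  have h2 : ordinalLength (W (r * n₀)) (W (r * (n₀ + t))) ≤
      ordinalLength (P n₀) (P (n₀ + (t + c))) := by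
    rw [← add_assoc n₀ t c]
    exact ordinalLength_mono (hPN _) (hPW _)
      ((hWmono (Nat.mul_le_mul_left r (Nat.le_add_right n₀ t))).trans (hWP _)) (hWP _)
  have h3 := (h1.trans h2).trans_lt (hPup _)
  rw [mul_lt_mul_iff_right₀ hpos, Nat.cast_lt] at h3
  have h4 : (k + k + 1) * t ≤ r * t := Nat.mul_le_mul_right t hr
  nlinarith

end Windows


/-! ### Application to lattices of submodules. -/

section Submodules

variable {S : Type u} [Ring S] {X : Type v} [AddCommGroup X] [Module S X]

/-- The action of the automorphisms of a module on its lattice of submodules. -/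
def submoduleAut : (X ≃ₗ[S] X) →* (Submodule S X ≃o Submodule S X) where
  toFun e := Submodule.orderIsoMapComap e
  map_one' := by
    ext N x
    simp
  map_mul' e f := by
    ext N x
    exact ⟨fun ⟨y, hy, h⟩ => ⟨f y, ⟨y, hy, rfl⟩, h⟩, fun ⟨_, ⟨y, hy, rfl⟩, h⟩ => ⟨y, hy, h⟩⟩

theorem mem_submoduleAut {e : X ≃ₗ[S] X} {N : Submodule S X} {x : X} :
    x ∈ submoduleAut e N ↔ ∃ y ∈ N, e y = x := Iff.rfl

theorem fg_submoduleAut (e : X ≃ₗ[S] X) {N : Submodule S X} (hN : N.FG) : (submoduleAut e N).FG :=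
  hN.map (e : X →ₗ[S] X)

theorem isNoetherianBelow_of_fg [IsNoetherianRing S] {N : Submodule S X} (hN : N.FG) :
    IsNoetherianBelow N := by
  have : IsNoetherian S N := isNoetherian_of_fg_of_noetherian N hN
  refine Subrelation.wf (r := InvImage (· > ·) fun M : Submodule S X => M.comap N.subtype) ?_
    (InvImage.wf _ (wellFounded_gt (α := Submodule S N)))
  rintro M M' ⟨h, h'⟩
  refine lt_of_le_not_ge (Submodule.comap_mono h.le) fun hle => h.not_ge fun x hx => ?_
  exact @hle ⟨x, h' hx⟩ hx

theorem exists_le_of_fg {P : ℕ → Submodule S X} (hP : Monotone P) (htop : ∀ x, ∃ n, x ∈ P n)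
    {N : Submodule S X} (hN : N.FG) : ∃ n, N ≤ P n := by
  obtain ⟨s, rfl⟩ := hN
  choose c hc using htop
  refine ⟨s.sup c, Submodule.span_le.2 fun x hx => hP (Finset.le_sup hx) (hc x)⟩

/-- A module over a Noetherian ring that is generated by the translates of a finitely generated
submodule under an automorphism with roots of unbounded order is finitely generated. -/
theorem finite_of_unbounded_roots [IsNoetherianRing S] (ζ : X ≃ₗ[S] X) {V : Submodule S X}
    (hV : V.FG) (htop : ⨆ i : ℤ, submoduleAut (ζ ^ i) V = ⊤)
    (hroots : ∀ K : ℕ, ∃ r > K, ∃ w : X ≃ₗ[S] X, w ^ r = ζ) : Module.Finite S X := by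
  have hfg : ∀ a b, (window (submoduleAut ζ) V a b).FG := fun a b => by
    rw [window]
    refine Submodule.fg_finset_sup _ _ fun i _ => ?_
    rw [← map_zpow]
    exact fg_submoduleAut _ hV
  have hexh : ∀ x : X, ∃ n : ℕ, x ∈ window (submoduleAut ζ) V (-n) n := fun x => by
    have hx : x ∈ ⨆ n : ℕ, window (submoduleAut ζ) V (-n) n := by
      have hle : (⊤ : Submodule S X) ≤ ⨆ n : ℕ, window (submoduleAut ζ) V (-n) n := by
        rw [← htop]
        refine iSup_le fun i => le_iSup_of_le i.natAbs ?_
        rw [map_zpow]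
        exact le_window (by lia) (by lia)
      exact hle trivial
    exact (Submodule.mem_iSup_of_directed _ monotone_window.directed_le).1 hx
  obtain ⟨n₀, hn₀⟩ := window_stabilizes (φ := submoduleAut ζ) (V := V)
    (fun a b => isNoetherianBelow_of_fg (hfg a b)) fun K => by
      obtain ⟨r, hr, w, hw⟩ := hroots K
      refine ⟨r, hr, submoduleAut w, by rw [← map_pow, hw], fun i => ?_⟩
      rw [← map_pow]
      -- The compatibility with windows is automatic: `w ^ i V` is finitely generated and the
      -- windows exhaust `X`.
      exact exists_le_of_fg monotone_window hexh (fg_submoduleAut _ hV)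
  refine ⟨?_⟩
  rw [← (eq_top_iff.2 fun x _ => ?_ : window (submoduleAut ζ) V (-n₀) n₀ = ⊤)]
  · exact hfg _ _
  · obtain ⟨n, hn⟩ := hexh x
    rw [← hn₀ (n₀ + n) (by lia)]
    refine (show window (submoduleAut ζ) V (-n) n ≤ _ from window_mono ?_ ?_) hn <;> lia

end Submodules

/-! ### Skew-polynomial and skew-Laurent extensions. -/

section Extensions

/-- A right module over an extension `A` of a right Noetherian ring `R` in which every element is a
sum of elements `b = r z ^ k` or `b z ^ k = r`, with `r ∈ R`, is finitely generated over `R` as soon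
as it is finitely generated over `A` and the multiplication by `z` has automorphisms as roots of
unbounded order. -/
theorem isFGOver_of_hasRootsOfMul {R A : Type u} [Ring R] [Ring A] [IsNoetherianRing Rᵐᵒᵖ]
    (f : R →+* A) (z : A)
    (hz : ∀ a : A, a ∈ AddSubmonoid.closure {b | ∃ r k, b = f r * z ^ k ∨ b * z ^ k = f r})
    (X : Type v) [AddCommGroup X] [Module Aᵐᵒᵖ X] [Module.Finite Aᵐᵒᵖ X]
    (h : HasRootsOfMul z X) : IsFGOver f X := by
  obtain ⟨r, w, -, hr, hw⟩ := h
  unfold IsFGOver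
  let : Module Rᵐᵒᵖ X := Module.compHom X f.op
  have hsmul : ∀ (a : R) (x : X), op a • x = op (f a) • x := fun _ _ => rfl
  let res : (X ≃ₗ[Aᵐᵒᵖ] X) → (X ≃ₗ[Rᵐᵒᵖ] X) := fun e =>
    { e.toAddEquiv with map_smul' := fun a x => e.map_smul (op (f (unop a))) x }
  have hres : ∀ e x, res e x = e x := fun _ _ => rfl
  have hpow : ∀ (e : X ≃ₗ[Aᵐᵒᵖ] X) (n : ℕ) x, (res e ^ n) x = (e ^ n) x := fun e n => by
    induction n with
    | zero => intro x; rfl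
    | succ n ih =>
      intro x
      rw [pow_succ, pow_succ, LinearEquiv.mul_apply, LinearEquiv.mul_apply, ih, hres]
  -- Multiplication by `z` need not be bijective or `R`-linear in general; having a single root
  -- among the automorphisms makes it both.
  set ζ : X ≃ₗ[Rᵐᵒᵖ] X := res (w 0) ^ r 0
  have hζ : ∀ x, ζ x = op z • x := fun x => (hpow _ _ _).trans (hw 0 x)
  have hζpow : ∀ (k : ℕ) x, (ζ ^ k) x = op (z ^ k) • x := fun k => by
    induction k with
    | zero => intro x; simp
    | succ k ih =>
      intro x
      rw [pow_succ, LinearEquiv.mul_apply, ih, hζ, smul_smul, ← op_mul, ← pow_succ']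
  obtain ⟨s, hs⟩ := (Module.Finite.fg_top : (⊤ : Submodule Aᵐᵒᵖ X).FG)
  set V : Submodule Rᵐᵒᵖ X := Submodule.span _ (s : Set X)
  refine finite_of_unbounded_roots ζ (V := V) ⟨s, rfl⟩ (eq_top_iff.2 fun x _ => ?_) fun K => ?_
  · have hVmem : ∀ a : A, ∀ v ∈ V, op a • v ∈ ⨆ i : ℤ, submoduleAut (ζ ^ i) V := fun a v hv => by
      induction hz a using AddSubmonoid.closure_induction with
      | zero => simp
      | add a b _ _ ha hb => rw [op_add, add_smul]; exact add_mem ha hb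
      | mem a ha =>
        obtain ⟨c, k, hk | hk⟩ := ha
        · refine Submodule.mem_iSup_of_mem (k : ℤ) (mem_submoduleAut.2
            ⟨op c • v, V.smul_mem _ hv, ?_⟩)
          rw [zpow_natCast, hζpow, hsmul, smul_smul, ← op_mul, hk]
        -- From `a * z ^ k = f c` it follows that `v a = ζ ^ (-k) (v c)`, even where `z` has no
        -- inverse in `A`.
        · refine Submodule.mem_iSup_of_mem (-(k : ℤ)) (mem_submoduleAut.2
            ⟨op c • v, V.smul_mem _ hv, ?_⟩)
          rw [hsmul, ← hk, op_mul, mul_smul, ← hζpow, ← LinearEquiv.mul_apply, ← zpow_natCast,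
            ← zpow_add, neg_add_cancel, zpow_zero]
          rfl
    have hx : x ∈ Submodule.span Aᵐᵒᵖ (s : Set X) := hs ▸ trivial
    rw [← Set.image_id (s : Set X), Finsupp.mem_span_image_iff_linearCombination] at hx
    obtain ⟨l, hl, rfl⟩ := hx
    rw [Finsupp.linearCombination_apply]
    exact sum_mem fun v hv => hVmem (unop (l v)) v (Submodule.subset_span (hl hv))
  · obtain ⟨j, hj⟩ := (hr.eventually_gt_atTop K).exists
    refine ⟨r j, hj, res (w j), LinearEquiv.ext fun x => ?_⟩
    rw [hpow, hw, hζ]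

theorem SkewPoly.mem_closure_monomials {R : Type u} [Ring R] (α : R ≃+* R) (a : SkewPoly α) :
    a ∈ AddSubmonoid.closure {b | ∃ r k, b = SkewPoly.C α r * SkewPoly.z α ^ k ∨
      b * SkewPoly.z α ^ k = SkewPoly.C α r} := by
  let := natAction α
  refine SkewPolynomial.induction (R := R) a (zero_mem _) fun n r q _ _ hq =>
    add_mem (AddSubmonoid.subset_closure ⟨r, n, Or.inl ?_⟩) hq
  exact (SkewPolynomial.C_mul_X_pow_eq_monomial (a := r) (n := n)).symm

/-- The monomial of `R[z^{±1};α]` of a given degree and coefficient. -/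
noncomputable def SkewLaurent.monomial {R : Type u} [Ring R] (α : R ≃+* R) (g : Multiplicative ℤ)
    (r : R) : SkewLaurent α :=
  SkewMonoidAlgebra.single g r

theorem SkewLaurent.monomial_mul_z_pow {R : Type u} [Ring R] (α : R ≃+* R) (g : Multiplicative ℤ)
    (r : R) (n : ℕ) :
    SkewLaurent.monomial α g r * SkewLaurent.z α ^ n =
      SkewLaurent.monomial α (g * Multiplicative.ofAdd (n : ℤ)) r := by
  let := intAction α
  induction n with
  | zero => simp
  | succ n ih =>
    rw [pow_succ, ← mul_assoc, ih]
    refine (SkewMonoidAlgebra.single_mul_single (k := R)).trans ?_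
    rw [smul_one, mul_one, mul_assoc, ← ofAdd_add, Nat.cast_succ]
    rfl

theorem SkewLaurent.mem_closure_monomials {R : Type u} [Ring R] (α : R ≃+* R)
    (a : SkewLaurent α) :
    a ∈ AddSubmonoid.closure {b | ∃ r k, b = SkewLaurent.C α r * SkewLaurent.z α ^ k ∨
      b * SkewLaurent.z α ^ k = SkewLaurent.C α r} := by
  refine SkewMonoidAlgebra.induction_on (k := R) a (zero_mem _) (fun g r => ?_)
    fun _ _ => add_mem
  refine AddSubmonoid.subset_closure ⟨r, g.toAdd.natAbs, ?_⟩
  rcases Int.natAbs_eq g.toAdd with h | h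
  · refine Or.inl (Eq.trans ?_ (SkewLaurent.monomial_mul_z_pow α 1 r _).symm)
    rw [← h, one_mul, ofAdd_toAdd]
    rfl
  · refine Or.inr ((SkewLaurent.monomial_mul_z_pow α g r _).trans ?_)
    rw [← neg_eq_iff_eq_neg.2 h, ofAdd_neg, ofAdd_toAdd, mul_inv_cancel]
    rfl

end Extensions

end SkewFG

open SkewFG in
theorem mainTheorem8 {R : Type u} [Ring R] (hR : IsPrimeNoetherianLocalizable R)
    (α : R ≃+* R) :
    (∀ (X : Type v) [AddCommGroup X] [Module (SkewPoly α)ᵐᵒᵖ X],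
      Module.Finite (SkewPoly α)ᵐᵒᵖ X →
      HasRootsOfMul (SkewPoly.z α) X →
      IsFGOver (SkewPoly.C α) X) ∧
    (IsPrimeNoetherianLocalizable (SkewPoly α) →
      ∀ (M : Type v) [AddCommGroup M] [Module (SkewLaurent α)ᵐᵒᵖ M],
        Module.Finite (SkewLaurent α)ᵐᵒᵖ M →
        HasRootsOfMul (SkewLaurent.z α) M →
        IsFGOver (SkewLaurent.C α) M) := by
  have := hR.noetherian_right
  exact ⟨fun X _ _ _ h => isFGOver_of_hasRootsOfMul _ _ (SkewPoly.mem_closure_monomials α) X h,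
    fun _ M _ _ _ h => isFGOver_of_hasRootsOfMul _ _ (SkewLaurent.mem_closure_monomials α) M h⟩
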